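/- Fix an oversampling factor $L\in\mathbb N$, $L\ge1$, a frequency noise variance $\sigma^2>0$ and a power $P>0$. The oversampled Wiener phase noise channel maps complex inputs $X_1,\dots,X_M$ to the outputs $$Y_n = X_{\lceil n/L\rceil}\,e^{j\Theta_n}+W_n,\qquad n=1,\dots,ML,$$ where $W_n\sim\mathcal{CN}(0,2)$ are i.i.d., $\Theta_0$ is uniform on $[0,2\pi)$, $\Theta_n=\Theta_{n-1}+N_n$ with $N_n\sim\mathcal N(0,\sigma^2/L)$ i.i.d., and $(X_m)_m$, $\Theta_0$, $(N_n)_n$, $(W_n)_n$ are mutually independent. Its capacity is $$\mathcal C(P,L,\sigma^2)=\lim_{M\to\infty}\ \sup\ \frac1M\, I(X_1^M;Y_1^{ML}),$$ where the supremum is over all laws of $(X_1,\dots,X_M)$ with $\frac1M\sum_{m=1}^M\mathbb E|X_m|^2\le P/L$ (the limit in $M$ being read as a lower limit, which is the limit whenever that exists). For $\alpha\ge0$ and $\beta\in\mathbb R$ the generalized degrees of freedom are $$D(\alpha,\beta)=\lim_{P\to\infty}\frac{\mathcal C(P,\lfloor P^\alpha\rfloor,P^\beta)}{\log P}.$$ Then,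 for all $\alpha\ge0$ and $\beta\in\mathbb R$, $$\liminf_{P\to\infty}\frac{\mathcal C(P,\lfloor P^\alpha\rfloor,P^\beta)}{\log P}\ \ge\ D^{\rm IN-CC}(\beta),\qquad D^{\rm IN-CC}(\beta)=\begin{cases}0,&\beta>0,\\ -\beta,&-1\le\beta\le0,\\ 1,&\beta\le-1;\end{cases}$$ in particular $D(\alpha,\beta)\ge D^{\rm IN-CC}(\beta)$ whenever the limit defining $D(\alpha,\beta)$ exists. -/

import Mathlib

open Filter Topology MeasureTheory ProbabilityTheory
open scoped ENNReal NNReal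

noncomputable section

namespace OWPN

/-- The uniform distribution on `[0, 2π)`. -/
def uniformPhase : Measure ℝ := ProbabilityTheory.cond volume (Set.Ico 0 (2 * Real.pi))

/-- The circularly symmetric complex Gaussian law `CN(0, v)`: real and imaginary parts are
independent real Gaussians of mean `0` and variance `v / 2`. -/
def complexGaussian (v : ℝ≥0) : Measure ℂ :=
  ((gaussianReal 0 (v / 2)).prod (gaussianReal 0 (v / 2))).map
    (fun p : ℝ × ℝ => (p.1 : ℂ) + (p.2 : ℂ) * Complex.I)

/-- The phase noise samples, from the initial phase `θ₀` and the increments `N`: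
`Θ_n = θ₀ + N_1 + ⋯ + N_n`, that is `Θ_n = Θ_{n-1} + N_n` with `Θ_0 = θ₀`.
The sample with (one-based) number `n` has the (zero-based) index `n - 1` in `Fin K`. -/
def phase {K : ℕ} (θ₀ : ℝ) (N : Fin K → ℝ) (n : Fin K) : ℝ :=
  θ₀ + ∑ i ∈ Finset.Iic n, N i

/-- The output `Y_n = X_{⌈n/L⌉} exp(j Θ_n) + W_n` of `M` input symbols with `L` samples each.
With zero-based indices `⌈n/L⌉` is the integer quotient of the index by `L`, `Fin.divNat`. -/
def output {M L : ℕ} (x : Fin M → ℂ) (θ₀ : ℝ) (N : Fin (M * L) → ℝ) (w : Fin (M * L) → ℂ)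
    (n : Fin (M * L)) : ℂ :=
  x n.divNat * Complex.exp (Complex.I * (phase θ₀ N n : ℂ)) + w n

/-- The joint law of the channel disturbances for `K` samples: `Θ_0` uniform on `[0, 2π)`,
increments `N_n` i.i.d. `N(0, s)`, additive noise `W_n` i.i.d. `CN(0, 2)`, all independent. -/
def noiseLaw (K : ℕ) (s : ℝ≥0) : Measure (ℝ × (Fin K → ℝ) × (Fin K → ℂ)) :=
  uniformPhase.prod
    ((Measure.pi fun _ : Fin K => gaussianReal 0 s).prod
      (Measure.pi fun _ : Fin K => complexGaussian 2))

/-- The joint law of input and output `(X, Y)` when the input has law `μ` and is independent of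
the disturbances; the phase increments have variance `σ² / L`. -/
def jointLaw {M : ℕ} (L : ℕ) (σsq : ℝ) (μ : Measure (Fin M → ℂ)) :
    Measure ((Fin M → ℂ) × (Fin (M * L) → ℂ)) :=
  (μ.prod (noiseLaw (M * L) (Real.toNNReal (σsq / L)))).map
    (fun p => (p.1, output p.1 p.2.1 p.2.2.1 p.2.2.2))

/-- The mutual information, in nats, of a pair of random variables with joint law `ρ`. -/
def mutualInfo {α β : Type*} [MeasurableSpace α] [MeasurableSpace β] (ρ : Measure (α × β)) :
    ℝ≥0∞ :=
  InformationTheory.klDiv ρ (ρ.fst.prod ρ.snd)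

/-- The admissible input laws for `M` symbols: probability measures with
`(1/M) ∑ E|X_n|² ≤ P / L`. -/
def inputLaws (M L : ℕ) (P : ℝ) : Set (Measure (Fin M → ℂ)) :=
  {μ | IsProbabilityMeasure μ ∧
    (M : ℝ≥0∞)⁻¹ * ∑ n, ∫⁻ x, ‖x n‖ₑ ^ 2 ∂μ ≤ ENNReal.ofReal (P / L)}

/-- `sup (1/M) I(X_1^M ; Y_1^{ML})` over the admissible input laws. -/
def blockRate (P : ℝ) (L : ℕ) (σsq : ℝ) (M : ℕ) : ℝ≥0∞ :=
  ⨆ μ ∈ inputLaws M L P, mutualInfo (jointLaw L σsq μ) / M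

/-- The capacity `lim_{M → ∞} sup (1/M) I(X_1^M ; Y_1^{ML})`, in nats per symbol. It is written as
the lower limit, which is the limit whenever that exists. -/
def capacity (P : ℝ) (L : ℕ) (σsq : ℝ) : ℝ≥0∞ :=
  liminf (blockRate P L σsq) atTop

/-- `C(P, ⌊P^α⌋, P^β) / log P`. -/
def capacityRatio (α β P : ℝ) : ℝ≥0∞ :=
  capacity P ⌊P ^ α⌋₊ (P ^ β) / ENNReal.ofReal (Real.log P)

/-- `D` is the generalized degrees of freedom `lim_{P → ∞} C(P, ⌊P^α⌋, P^β) / log P`. -/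
def IsGDoF (α β : ℝ) (D : ℝ≥0∞) : Prop :=
  Tendsto (capacityRatio α β) atTop (𝓝 D)

/-- The coherent combining lower bound. -/
def gdofInCC (β : ℝ) : ℝ :=
  if 0 < β then 0 else if -1 ≤ β then -β else 1

instance : IsProbabilityMeasure uniformPhase := by
  refine ProbabilityTheory.cond_isProbabilityMeasure_of_finite ?_ ?_ <;>
    simp [Real.volume_Ico, Real.pi_pos, ENNReal.mul_eq_top]

instance (v : ℝ≥0) : IsProbabilityMeasure (complexGaussian v) :=
  Measure.isProbabilityMeasure_map (by fun_prop)

instance (K : ℕ) (s : ℝ≥0) : IsProbabilityMeasure (noiseLaw K s) := by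
  unfold noiseLaw; infer_instance

/-- The input-output map is measurable, so `jointLaw` is a genuine image measure. -/
theorem measurable_output (M L : ℕ) :
    Measurable (fun p : (Fin M → ℂ) × ℝ × (Fin (M * L) → ℝ) × (Fin (M * L) → ℂ) =>
      (p.1, output p.1 p.2.1 p.2.2.1 p.2.2.2)) := by
  unfold output phase
  fun_prop

theorem isProbabilityMeasure_jointLaw {M : ℕ} (L : ℕ) (σsq : ℝ) (μ : Measure (Fin M → ℂ))
    [IsProbabilityMeasure μ] : IsProbabilityMeasure (jointLaw L σsq μ) :=
  Measure.isProbabilityMeasure_map (measurable_output M L).aemeasurable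

end OWPN

end

/-!
The lower bound comes from an explicit scheme: independent inputs, coherent combining of the `L`
samples of a symbol, and differential detection, in which each symbol serves as the phase reference
for the next one.

Put `A² = P / L` and `ε² = σ² + 1 / P`. Each input symbol is uniform on a disc contained in the
annulus `A / 2 ≤ ‖x‖ ≤ A`, so the power constraint holds and block means close to `0` are exceptional. The
mean `Z_m` of the samples of block `m` is `X_m` times a common phase factor, up to an error of mean
square `O(A² ε²)`: the phase drifts by `O(σ²)` in mean square over two blocks
(`integral_deviation_le`), and averaging `L` noise samples leaves a variance `2 / L = 2 A² / P`. Hence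
`X_m Z_{m+1} / Z_m` predicts `X_{m+1}` with a mean squared error `O(A² ε²)`
(`norm_sub_predict_sq_le`).

The mutual information is bounded below through the variational inequality
`∫ f dμ - log ∫ exp f dν ≤ D(μ ‖ ν)` (`ofReal_integral_sub_log_integral_exp_le_klDiv`), where `f` is
minus the sum of the squared prediction errors divided by `A² ε²`. Under the joint law its mean is
at least `-256` per predicted symbol (`le_integral_metric`). Under the product of the marginals,
`exp f` is, for each fixed output, a product of Gaussian kernels along the chain of inputs.
Integrating the last input first, each kernel contributes at most `16 ε²`, because the input density
is at most `16 / (π A²)` (`lintegral_prod_chain_le`, `integral_exp_metric_le`). The capacity is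
therefore at least `log (1 / ε²)` minus a constant (`le_capacity`). With `σ² = P ^ β` and `β ≤ 0`,
`log (1 / ε²)` is at least `gdofInCC β * log P - log 2`.
-/

namespace OWPN


/-! ### A variational lower bound on the relative entropy -/

/-- The Donsker–Varadhan lower bound on the relative entropy: Gibbs' inequality for `μ` and
the tilted measure `ν.tilted f`. -/
theorem ofReal_integral_sub_log_integral_exp_le_klDiv {α : Type*} [MeasurableSpace α]
    {μ ν : Measure α} [IsProbabilityMeasure μ] [IsProbabilityMeasure ν] {f : α → ℝ}
    (hf : Integrable f μ) (hexp : Integrable (fun x => Real.exp (f x)) ν) :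
    ENNReal.ofReal (∫ x, f x ∂μ - Real.log (∫ x, Real.exp (f x) ∂ν))
      ≤ InformationTheory.klDiv μ ν := by
  by_cases h : μ ≪ ν ∧ Integrable (llr μ ν) μ
  · obtain ⟨hac, hint⟩ := h
    have : IsProbabilityMeasure (ν.tilted f) := isProbabilityMeasure_tilted hexp
    have hac' : μ ≪ ν.tilted f := hac.trans (absolutelyContinuous_tilted hexp)
    have gibbs := InformationTheory.integral_llr_add_sub_measure_univ_nonneg hac'
      (integrable_llr_tilted_right hac hf hint hexp)
    rw [integral_llr_tilted_right hac hf hexp hint] at gibbs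
    rw [InformationTheory.klDiv_of_ac_of_integrable hac hint]
    simp only [probReal_univ] at gibbs ⊢
    exact ENNReal.ofReal_le_ofReal (by linarith)
  · have : InformationTheory.klDiv μ ν = ∞ := by
      rw [InformationTheory.klDiv_eq_top_iff]
      tauto
    simp [this]

/-! ### Second moments of sums of independent variables -/

theorem integrable_sq_sum_pi {ι Ω : Type*} [Fintype ι] [MeasurableSpace Ω] {ν : Measure Ω}
    [IsProbabilityMeasure ν] {X : Ω → ℝ} (hX : MemLp X 2 ν) (S : Finset ι) :
    Integrable (fun ω : ι → Ω => (∑ i ∈ S, X (ω i)) ^ 2) (Measure.pi fun _ => ν) := by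
  refine MemLp.integrable_sq (memLp_finsetSum S fun i _ => ?_)
  exact hX.comp_measurePreserving (measurePreserving_eval _ i)

theorem integral_sq_sum_pi {ι Ω : Type*} [Fintype ι] [MeasurableSpace Ω] {ν : Measure Ω}
    [IsProbabilityMeasure ν] {X : Ω → ℝ} (hX : MemLp X 2 ν) (h0 : ∫ x, X x ∂ν = 0)
    (S : Finset ι) :
    ∫ ω : ι → Ω, (∑ i ∈ S, X (ω i)) ^ 2 ∂(Measure.pi fun _ => ν) = S.card * Var[X; ν] := by
  classical
  have hY : ∀ i : ι, MemLp (if i ∈ S then X else 0) 2 ν := by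
    intro i
    split_ifs
    exacts [hX, MemLp.zero]
  have hsum : (∑ i, fun ω : ι → Ω => (if i ∈ S then X else 0) (ω i))
      = fun ω => ∑ i ∈ S, X (ω i) := by
    funext ω
    rw [Finset.sum_apply, ← Finset.sum_filter_add_sum_filter_not Finset.univ (· ∈ S)]
    rw [Finset.sum_congr rfl (g := fun i => X (ω i)) (by intro i hi; simp_all),
      Finset.sum_eq_zero (s := Finset.univ.filter (· ∉ S)) (by intro i hi; simp_all)]
    simp
  have hvar := variance_sum_pi (μ := fun _ : ι => ν) hY
  rw [hsum] at hvar
  rw [← variance_of_integral_eq_zero, hvar]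
  · rw [← Finset.sum_filter_add_sum_filter_not Finset.univ (· ∈ S)]
    rw [Finset.sum_congr rfl (g := fun i => Var[X; ν]) (by intro i hi; simp_all),
      Finset.sum_eq_zero (s := Finset.univ.filter (· ∉ S)) (by intro i hi; simp_all [variance_zero])]
    simp
  · exact (memLp_finsetSum S fun i _ =>
      hX.comp_measurePreserving (measurePreserving_eval _ i)).aestronglyMeasurable.aemeasurable
  · rw [integral_finsetSum]
    · refine Finset.sum_eq_zero fun i _ => ?_
      rw [← h0]
      exact integral_comp_eval (i := i) hX.aestronglyMeasurable
    · intro i _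
      exact (hX.comp_measurePreserving (measurePreserving_eval _ i)).integrable (by norm_num)

theorem measurePreserving_re_complexGaussian (v : ℝ≥0) :
    MeasurePreserving Complex.re (complexGaussian v) (gaussianReal 0 (v / 2)) := by
  refine ⟨Complex.measurable_re, ?_⟩
  rw [complexGaussian, Measure.map_map Complex.measurable_re (by fun_prop)]
  convert (measurePreserving_fst (μ := gaussianReal 0 (v / 2))
    (ν := gaussianReal 0 (v / 2))).map_eq using 2
  ext p
  simp

theorem measurePreserving_im_complexGaussian (v : ℝ≥0) :
    MeasurePreserving Complex.im (complexGaussian v) (gaussianReal 0 (v / 2)) := by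
  refine ⟨Complex.measurable_im, ?_⟩
  rw [complexGaussian, Measure.map_map Complex.measurable_im (by fun_prop)]
  convert (measurePreserving_snd (μ := gaussianReal 0 (v / 2))
    (ν := gaussianReal 0 (v / 2))).map_eq using 2
  ext p
  simp

theorem integrable_normSq_sum_complexGaussian {ι : Type*} [Fintype ι] (v : ℝ≥0) (S : Finset ι) :
    Integrable (fun w : ι → ℂ => ‖∑ i ∈ S, w i‖ ^ 2) (Measure.pi fun _ => complexGaussian v) := by
  have hre := (memLp_id_gaussianReal (μ := 0) (v := v / 2) 2).comp_measurePreserving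
    (measurePreserving_re_complexGaussian v)
  have him := (memLp_id_gaussianReal (μ := 0) (v := v / 2) 2).comp_measurePreserving
    (measurePreserving_im_complexGaussian v)
  refine ((integrable_sq_sum_pi hre S).add (integrable_sq_sum_pi him S)).congr
    (ae_of_all _ fun w => ?_)
  beta_reduce
  rw [Complex.sq_norm, Complex.normSq_apply]
  simp [sq]

theorem integral_normSq_sum_complexGaussian {ι : Type*} [Fintype ι] (v : ℝ≥0) (S : Finset ι) :
    ∫ w : ι → ℂ, ‖∑ i ∈ S, w i‖ ^ 2 ∂(Measure.pi fun _ => complexGaussian v) = S.card * v := by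
  have pre := measurePreserving_re_complexGaussian v
  have pim := measurePreserving_im_complexGaussian v
  have hre := (memLp_id_gaussianReal (μ := 0) (v := v / 2) 2).comp_measurePreserving pre
  have him := (memLp_id_gaussianReal (μ := 0) (v := v / 2) 2).comp_measurePreserving pim
  have h0re : ∫ z, (id ∘ Complex.re) z ∂(complexGaussian v) = 0 := by
    have := integral_map (μ := complexGaussian v) Complex.measurable_re.aemeasurable
      (f := id) aestronglyMeasurable_id
    rw [pre.map_eq] at this
    simpa using this.symm
  have h0im : ∫ z, (id ∘ Complex.im) z ∂(complexGaussian v) = 0 := by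
    have := integral_map (μ := complexGaussian v) Complex.measurable_im.aemeasurable
      (f := id) aestronglyMeasurable_id
    rw [pim.map_eq] at this
    simpa using this.symm
  have hvre : Var[id ∘ Complex.re; complexGaussian v] = v / 2 := by
    rw [← variance_map aemeasurable_id Complex.measurable_re.aemeasurable, pre.map_eq]
    simp
  have hvim : Var[id ∘ Complex.im; complexGaussian v] = v / 2 := by
    rw [← variance_map aemeasurable_id Complex.measurable_im.aemeasurable, pim.map_eq]
    simp
  have key : ∀ w : ι → ℂ, ‖∑ i ∈ S, w i‖ ^ 2
      = (∑ i ∈ S, (id ∘ Complex.re) (w i)) ^ 2 + (∑ i ∈ S, (id ∘ Complex.im) (w i)) ^ 2 := by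
    intro w
    rw [Complex.sq_norm, Complex.normSq_apply]
    simp [sq]
  simp_rw [key]
  rw [integral_add (integrable_sq_sum_pi hre S) (integrable_sq_sum_pi him S),
    integral_sq_sum_pi hre h0re, integral_sq_sum_pi him h0im, hvre, hvim]
  ring

/-! ### Integrating a product of transition kernels -/

/-- A product of kernels along the chain `x₀, …, xₙ` is integrated starting from the last variable:
each factor then contributes at most the uniform bound `c` on its integral. -/
theorem lintegral_prod_chain_le {E : Type*} [MeasurableSpace E] {ν : Measure E}
    [IsProbabilityMeasure ν] {c : ℝ≥0∞} (n : ℕ) (k : Fin n → E → E → ℝ≥0∞)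
    (hk : ∀ i, Measurable (Function.uncurry (k i))) (hc : ∀ i a, ∫⁻ b, k i a b ∂ν ≤ c) :
    ∫⁻ x : Fin (n + 1) → E, ∏ i : Fin n, k i (x i.castSucc) (x i.succ) ∂(Measure.pi fun _ => ν)
      ≤ c ^ n := by
  induction n with
  | zero => simp
  | succ n ih =>
    have hm : Measurable fun x : Fin (n + 1 + 1) → E =>
        ∏ i : Fin (n + 1), k i (x i.castSucc) (x i.succ) :=
      Finset.measurable_prod _ fun i _ =>
        (hk i).comp (f := fun x : Fin (n + 1 + 1) → E => (x i.castSucc, x i.succ)) (by fun_prop)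
    have hm' : Measurable fun x : Fin (n + 1) → E =>
        ∏ i : Fin n, k i.castSucc (x i.castSucc) (x i.succ) :=
      Finset.measurable_prod _ fun i _ =>
        (hk i.castSucc).comp (f := fun x : Fin (n + 1) → E => (x i.castSucc, x i.succ))
          (by fun_prop)
    have mp := (measurePreserving_piFinSuccAbove (fun _ : Fin (n + 1 + 1) => ν)
      (Fin.last (n + 1))).symm
    rw [← mp.lintegral_comp hm]
    refine (lintegral_prod_symm' _ (hm.comp mp.measurable)).trans_le ?_
    calc _ = ∫⁻ x : Fin (n + 1) → E, (∏ i : Fin n, k i.castSucc (x i.castSucc) (x i.succ)) *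
            ∫⁻ b, k (Fin.last n) (x (Fin.last n)) b ∂ν ∂(Measure.pi fun _ => ν) := by
          refine lintegral_congr fun x => ?_
          have hmk : Measurable (k (Fin.last n) (x (Fin.last n))) :=
            (hk (Fin.last n)).comp measurable_prodMk_left
          rw [← lintegral_const_mul _ hmk]
          refine lintegral_congr fun b => ?_
          simp only [Function.comp_apply, MeasurableEquiv.piFinSuccAbove_symm_apply, Fin.insertNthEquiv,
            Equiv.coe_fn_mk, Fin.insertNth_last', Fin.prod_univ_castSucc, Fin.snoc_castSucc,
            Fin.succ_castSucc, Fin.succ_last, Fin.snoc_last]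
      _ ≤ ∫⁻ x : Fin (n + 1) → E, (∏ i : Fin n, k i.castSucc (x i.castSucc) (x i.succ)) * c
            ∂(Measure.pi fun _ => ν) := by
          gcongr
          exact hc _ _
      _ ≤ c ^ (n + 1) := by
          rw [lintegral_mul_const _ hm', pow_succ]
          gcongr
          exact ih _ (fun i => hk _) fun i => hc _


/-! ### The input law -/

/-- The law of one input symbol: uniform on a disc that lies in the annulus `A / 2 ≤ ‖x‖ ≤ A`. -/
noncomputable def symbolLaw (A : ℝ) : Measure ℂ :=
  ProbabilityTheory.cond volume (Metric.closedBall (3 * A / 4 : ℂ) (A / 4))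

theorem volume_disc_ne_zero {A : ℝ} (hA : 0 < A) :
    volume (Metric.closedBall (3 * A / 4 : ℂ) (A / 4)) ≠ 0 := by
  rw [Complex.volume_closedBall]
  have h1 : ENNReal.ofReal (A / 4) ≠ 0 := by simpa using hA
  have h2 : (NNReal.pi : ℝ≥0∞) ≠ 0 := by simpa using NNReal.pi_ne_zero
  exact mul_ne_zero (pow_ne_zero _ h1) h2

theorem isProbabilityMeasure_symbolLaw {A : ℝ} (hA : 0 < A) :
    IsProbabilityMeasure (symbolLaw A) :=
  cond_isProbabilityMeasure_of_finite (volume_disc_ne_zero hA)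
    (measure_closedBall_lt_top).ne

theorem ae_symbolLaw {A : ℝ} (hA : 0 < A) : ∀ᵐ x ∂symbolLaw A, A / 2 ≤ ‖x‖ ∧ ‖x‖ ≤ A := by
  filter_upwards [ae_cond_mem (μ := volume) (Metric.isClosed_closedBall.measurableSet :
    MeasurableSet (Metric.closedBall (3 * A / 4 : ℂ) (A / 4)))] with x hx
  rw [mem_closedBall_iff_norm] at hx
  have hc : ‖(3 * A / 4 : ℂ)‖ = 3 * A / 4 := by
    have : (3 * A / 4 : ℂ) = ((3 * A / 4 : ℝ) : ℂ) := by push_cast; ring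
    rw [this, Complex.norm_real, Real.norm_of_nonneg (by positivity)]
  have h1 := norm_sub_norm_le x (3 * A / 4 : ℂ)
  have h2 := norm_sub_norm_le (3 * A / 4 : ℂ) x
  rw [norm_sub_rev] at h2
  constructor <;> linarith

/-- The density of `symbolLaw A` is at most `16 / (π A²)`, which bounds the mass of a Gaussian
kernel uniformly in its centre. -/
theorem lintegral_gaussianKernel_symbolLaw_le {A b : ℝ} (hA : 0 < A) (hb : 0 < b) (z : ℂ) :
    ∫⁻ x, ENNReal.ofReal (Real.exp (-b * ‖x - z‖ ^ 2)) ∂symbolLaw A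
      ≤ ENNReal.ofReal (16 / (A ^ 2 * b)) := by
  have hgauss : ∫ v : ℂ, Real.exp (-b * ‖v‖ ^ 2) = Real.pi / b := by
    rw [GaussianFourier.integral_rexp_neg_mul_sq_norm hb]
    simp
  have hint : Integrable fun v : ℂ => Real.exp (-b * ‖v‖ ^ 2) := by
    by_contra h
    rw [integral_undef h] at hgauss
    have : 0 < Real.pi / b := by positivity
    linarith
  have hvol : volume (Metric.closedBall (3 * A / 4 : ℂ) (A / 4))
      = ENNReal.ofReal (A ^ 2 * Real.pi / 16) := by
    rw [Complex.volume_closedBall, ← ENNReal.ofReal_pow (by positivity), ← ENNReal.ofReal_coe_nnreal,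
      ← ENNReal.ofReal_mul (by positivity)]
    congr 1
    simp only [NNReal.coe_real_pi]
    ring
  rw [symbolLaw, ProbabilityTheory.cond, lintegral_smul_measure, hvol,
    ← ENNReal.ofReal_inv_of_pos (by positivity), smul_eq_mul]
  calc _ ≤ ENNReal.ofReal (A ^ 2 * Real.pi / 16)⁻¹ *
        ∫⁻ x, ENNReal.ofReal (Real.exp (-b * ‖x - z‖ ^ 2)) := by
        gcongr
        exact Measure.restrict_le_self
    _ = ENNReal.ofReal (16 / (A ^ 2 * b)) := by
        rw [lintegral_sub_right_eq_self (fun x => ENNReal.ofReal (Real.exp (-b * ‖x‖ ^ 2))) z,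
          ← ofReal_integral_eq_lintegral_ofReal hint (ae_of_all _ fun _ => (Real.exp_pos _).le),
          hgauss, ← ENNReal.ofReal_mul (by positivity)]
        congr 1
        field_simp

/-! ### Differential prediction from coherently combined samples -/

/-- Coherent combining: the average of the `L` output samples that belong to symbol `m`. -/
noncomputable def blockMean {M L : ℕ} (y : Fin (M * L) → ℂ) (m : Fin M) : ℂ :=
  (L : ℂ)⁻¹ * ∑ l : Fin L, y (finProdFinEquiv (m, l))

/-- The differential estimate of a symbol from its own block mean `z'`, the preceding symbol `a` and
the preceding block mean `z`. The unknown common phase cancels in `z' / z`. The estimate is `0` when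
`z` is smaller than the threshold `c`, so that the division is never by a small number. -/
noncomputable def predict (c : ℝ) (a z z' : ℂ) : ℂ :=
  if c ≤ ‖z‖ then a * z' / z else 0

theorem measurable_predict (c : ℝ) :
    Measurable fun p : ℂ × ℂ × ℂ => predict c p.1 p.2.1 p.2.2 := by
  unfold predict
  exact Measurable.ite (measurableSet_le measurable_const (by fun_prop)) (by fun_prop)
    measurable_const

@[fun_prop]
theorem measurable_blockMean {M L : ℕ} (m : Fin M) :
    Measurable fun y : Fin (M * L) → ℂ => blockMean y m := by
  unfold blockMean
  fun_prop

/-- The prediction error is controlled by the deviations of the two block means from the symbols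
rotated by a common phase factor `ω`. Below the threshold `A / 4` the first deviation alone is at
least `A / 4`, so it dominates the error of the estimate `0`. -/
theorem norm_sub_predict_sq_le {A : ℝ} {a b ω z z' : ℂ} (hA : 0 < A) (ha : A / 2 ≤ ‖a‖)
    (ha' : ‖a‖ ≤ A) (hb : ‖b‖ ≤ A) (hω : ‖ω‖ = 1) :
    ‖b - predict (A / 4) a z z'‖ ^ 2 ≤ 32 * (‖z - a * ω‖ ^ 2 + ‖z' - b * ω‖ ^ 2) := by
  unfold predict
  split_ifs with h
  · have hz : 0 < ‖z‖ := lt_of_lt_of_le (by positivity) h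
    have hz0 : z ≠ 0 := norm_pos_iff.mp hz
    have heq : b - a * z' / z = (b * (z - a * ω) - a * (z' - b * ω)) / z := by
      field_simp
      ring
    have hle : ‖b - a * z' / z‖ ≤ 4 * (‖z - a * ω‖ + ‖z' - b * ω‖) := by
      rw [heq, norm_div, div_le_iff₀ hz]
      calc _ ≤ ‖b‖ * ‖z - a * ω‖ + ‖a‖ * ‖z' - b * ω‖ := by
            rw [← norm_mul, ← norm_mul]
            exact norm_sub_le _ _
        _ ≤ A * ‖z - a * ω‖ + A * ‖z' - b * ω‖ := by gcongr
        _ = 4 * (‖z - a * ω‖ + ‖z' - b * ω‖) * (A / 4) := by ring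
        _ ≤ _ := by gcongr
    calc _ ≤ (4 * (‖z - a * ω‖ + ‖z' - b * ω‖)) ^ 2 := by gcongr
      _ ≤ _ := by nlinarith [sq_nonneg (‖z - a * ω‖ - ‖z' - b * ω‖)]
  · push Not at h
    have h1 : A / 4 ≤ ‖z - a * ω‖ := by
      have := norm_sub_norm_le (a * ω) z
      rw [norm_sub_rev, norm_mul, hω, mul_one] at this
      linarith
    have h2 : ‖b‖ ^ 2 ≤ A ^ 2 := by gcongr
    have h3 : (A / 4) ^ 2 ≤ ‖z - a * ω‖ ^ 2 := by gcongr
    simp only [sub_zero]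
    nlinarith [sq_nonneg ‖z' - b * ω‖, sq_nonneg ‖z - a * ω‖]

/-- A bound, in terms of the disturbances, for the squared deviation of the mean of block `m` from
the symbol of modulus at most `A` rotated by the phase at the sample `r`. The phase enters through
differences only, so the initial phase is set to `0`. -/
noncomputable def deviation {M L : ℕ} (A : ℝ) (r : Fin (M * L)) (m : Fin M)
    (N : Fin (M * L) → ℝ) (w : Fin (M * L) → ℂ) : ℝ :=
  2 * (A ^ 2 * ((L : ℝ)⁻¹ *
      ∑ l : Fin L, (phase 0 N (finProdFinEquiv (m, l)) - phase 0 N r) ^ 2) +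
    (L : ℝ)⁻¹ ^ 2 * ‖∑ l : Fin L, w (finProdFinEquiv (m, l))‖ ^ 2)

theorem norm_blockMean_output_sub_sq_le {M L : ℕ} (hL : 0 < L) {A : ℝ} {x : Fin M → ℂ}
    (r : Fin (M * L)) (m : Fin M) (hx : ‖x m‖ ≤ A) (θ₀ : ℝ) (N : Fin (M * L) → ℝ)
    (w : Fin (M * L) → ℂ) :
    ‖blockMean (output x θ₀ N w) m - x m * Complex.exp (Complex.I * phase θ₀ N r)‖ ^ 2
      ≤ deviation A r m N w := by
  have hL' : (L : ℂ) ≠ 0 := by exact_mod_cast hL.ne'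
  set d : Fin L → ℝ := fun l => phase 0 N (finProdFinEquiv (m, l)) - phase 0 N r with hd
  set ω := Complex.exp (Complex.I * phase θ₀ N r) with hω
  have hω1 : ‖ω‖ = 1 := Complex.norm_exp_I_mul_ofReal _
  have hsplit : ∀ l : Fin L, output x θ₀ N w (finProdFinEquiv (m, l))
      = x m * ω + x m * ω * (Complex.exp (Complex.I * d l) - 1) + w (finProdFinEquiv (m, l)) := by
    intro l
    have hdiv : (finProdFinEquiv (m, l)).divNat = m :=
      congrArg Prod.fst (finProdFinEquiv.symm_apply_apply (m, l))
    have hphase : Complex.exp (Complex.I * phase θ₀ N (finProdFinEquiv (m, l)))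
        = ω * Complex.exp (Complex.I * d l) := by
      rw [hω, ← Complex.exp_add, ← mul_add]
      congr 2
      simp only [hd, phase]
      push_cast
      ring
    rw [output, hdiv, hphase]
    ring
  have hmean : blockMean (output x θ₀ N w) m - x m * ω
      = x m * ω * ((L : ℂ)⁻¹ * ∑ l, (Complex.exp (Complex.I * d l) - 1))
        + (L : ℂ)⁻¹ * ∑ l, w (finProdFinEquiv (m, l)) := by
    simp only [blockMean, hsplit, Finset.sum_add_distrib, Finset.sum_const, Finset.card_univ,
      Fintype.card_fin, nsmul_eq_mul, ← Finset.mul_sum]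
    field_simp
    ring
  have hrot : ‖∑ l, (Complex.exp (Complex.I * d l) - 1)‖ ^ 2 ≤ L * ∑ l, d l ^ 2 := by
    calc _ ≤ (∑ l, |d l|) ^ 2 := by
          gcongr
          exact (norm_sum_le _ _).trans
            (Finset.sum_le_sum fun l _ => Real.norm_exp_I_mul_ofReal_sub_one_le)
      _ ≤ L * ∑ l, |d l| ^ 2 := by
          simpa using sq_sum_le_card_mul_sum_sq (s := Finset.univ) (f := fun l => |d l|)
      _ = _ := by simp
  rw [hmean]
  calc _ ≤ 2 * (‖x m * ω * ((L : ℂ)⁻¹ * ∑ l, (Complex.exp (Complex.I * d l) - 1))‖ ^ 2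
        + ‖(L : ℂ)⁻¹ * ∑ l, w (finProdFinEquiv (m, l))‖ ^ 2) := by
        refine le_trans ?_ add_sq_le
        gcongr
        exact norm_add_le _ _
    _ = 2 * (‖x m‖ ^ 2 * ((L : ℝ)⁻¹ ^ 2 * ‖∑ l, (Complex.exp (Complex.I * d l) - 1)‖ ^ 2)
        + (L : ℝ)⁻¹ ^ 2 * ‖∑ l, w (finProdFinEquiv (m, l))‖ ^ 2) := by
        simp only [norm_mul, norm_inv, Complex.norm_natCast, hω1]
        ring
    _ ≤ 2 * (A ^ 2 * ((L : ℝ)⁻¹ ^ 2 * (L * ∑ l, d l ^ 2))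
        + (L : ℝ)⁻¹ ^ 2 * ‖∑ l, w (finProdFinEquiv (m, l))‖ ^ 2) := by gcongr
    _ = deviation A r m N w := by
        simp only [deviation, hd]
        field_simp

/-! ### The mean squared deviation -/

theorem phase_sub_phase {K : ℕ} (θ₀ : ℝ) (N : Fin K → ℝ) {r n : Fin K} (h : r ≤ n) :
    phase θ₀ N n - phase θ₀ N r = ∑ i ∈ Finset.Ioc r n, N i := by
  have hdisj : Disjoint (Finset.Iic r) (Finset.Ioc r n) :=
    Finset.disjoint_left.mpr fun i hi hi' => by
      simp only [Finset.mem_Iic, Finset.mem_Ioc] at hi hi'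
      exact absurd hi'.1 (not_lt.mpr hi)
  have hunion : Finset.Iic n = (Finset.Iic r).disjUnion (Finset.Ioc r n) hdisj := by
    ext i
    simp only [Finset.mem_Iic, Finset.mem_disjUnion, Finset.mem_Ioc]
    grind
  rw [phase, phase, hunion, Finset.sum_disjUnion]
  ring

theorem integrable_sq_phase_sub {K : ℕ} (s : ℝ≥0) {r n : Fin K} (h : r ≤ n) :
    Integrable (fun N : Fin K → ℝ => (phase 0 N n - phase 0 N r) ^ 2)
      (Measure.pi fun _ => gaussianReal 0 s) := by
  simp_rw [phase_sub_phase 0 _ h]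
  exact integrable_sq_sum_pi (memLp_id_gaussianReal 2) _

theorem integral_sq_phase_sub {K : ℕ} (s : ℝ≥0) {r n : Fin K} (h : r ≤ n) :
    ∫ N : Fin K → ℝ, (phase 0 N n - phase 0 N r) ^ 2 ∂(Measure.pi fun _ => gaussianReal 0 s)
      = ((n : ℕ) - r : ℕ) * s := by
  simp_rw [phase_sub_phase 0 _ h]
  have := integral_sq_sum_pi (memLp_id_gaussianReal (μ := 0) (v := s) 2)
    (by simp) (Finset.Ioc r n)
  rw [variance_id_gaussianReal, Fin.card_Ioc] at this
  simpa using this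

theorem measurePreserving_increments (K : ℕ) (s : ℝ≥0) :
    MeasurePreserving (fun p : ℝ × (Fin K → ℝ) × (Fin K → ℂ) => p.2.1) (noiseLaw K s)
      (Measure.pi fun _ => gaussianReal 0 s) :=
  measurePreserving_fst.comp measurePreserving_snd

theorem measurePreserving_additiveNoise (K : ℕ) (s : ℝ≥0) :
    MeasurePreserving (fun p : ℝ × (Fin K → ℝ) × (Fin K → ℂ) => p.2.2) (noiseLaw K s)
      (Measure.pi fun _ => complexGaussian 2) :=
  measurePreserving_snd.comp measurePreserving_snd

/-- The indices of the samples that belong to symbol `m`. -/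
def blockSamples {M : ℕ} (L : ℕ) (m : Fin M) : Finset (Fin (M * L)) :=
  Finset.univ.map ⟨fun l : Fin L => finProdFinEquiv (m, l),
    fun _ _ h => congrArg Prod.snd (finProdFinEquiv.injective h)⟩

theorem sum_blockSamples {M L : ℕ} (m : Fin M) (w : Fin (M * L) → ℂ) :
    ∑ l : Fin L, w (finProdFinEquiv (m, l)) = ∑ i ∈ blockSamples L m, w i := by
  rw [blockSamples, Finset.sum_map]
  rfl

theorem card_blockSamples {M : ℕ} (L : ℕ) (m : Fin M) : (blockSamples L m).card = L := by
  simp [blockSamples]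

theorem integrable_deviation {M L : ℕ} (s : ℝ≥0) (A : ℝ) (r : Fin (M * L)) (m : Fin M)
    (hr : ∀ l : Fin L, r ≤ finProdFinEquiv (m, l)) :
    Integrable (fun p => deviation A r m p.2.1 p.2.2) (noiseLaw (M * L) s) := by
  unfold deviation
  refine Integrable.const_mul (Integrable.add (Integrable.const_mul (Integrable.const_mul
    (integrable_finsetSum _ fun l _ => ?_) _) _) (Integrable.const_mul ?_ _)) _
  · exact (measurePreserving_increments _ s).integrable_comp_of_integrable
      (integrable_sq_phase_sub s (hr l))
  · simp_rw [sum_blockSamples]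
    exact (measurePreserving_additiveNoise _ s).integrable_comp_of_integrable
      (integrable_normSq_sum_complexGaussian 2 _)

theorem integral_deviation_le {M L : ℕ} (hL : 0 < L) (s : ℝ≥0) (A : ℝ) (r : Fin (M * L))
    (m : Fin M) (hr : ∀ l : Fin L, r ≤ finProdFinEquiv (m, l))
    (hr' : ∀ l : Fin L, (finProdFinEquiv (m, l) : ℕ) ≤ r + 2 * L) :
    ∫ p, deviation A r m p.2.1 p.2.2 ∂(noiseLaw (M * L) s)
      ≤ 2 * (A ^ 2 * (2 * L * s) + 2 / L) := by
  have hL' : (0 : ℝ) < L := by exact_mod_cast hL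
  have iP : ∀ l : Fin L, Integrable (fun p : ℝ × (Fin (M * L) → ℝ) × (Fin (M * L) → ℂ) =>
      (phase 0 p.2.1 (finProdFinEquiv (m, l)) - phase 0 p.2.1 r) ^ 2) (noiseLaw (M * L) s) :=
    fun l => (measurePreserving_increments _ s).integrable_comp_of_integrable
      (integrable_sq_phase_sub s (hr l))
  have iW : Integrable (fun p : ℝ × (Fin (M * L) → ℝ) × (Fin (M * L) → ℂ) =>
      ‖∑ l : Fin L, p.2.2 (finProdFinEquiv (m, l))‖ ^ 2) (noiseLaw (M * L) s) := by
    simp_rw [sum_blockSamples]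
    exact (measurePreserving_additiveNoise _ s).integrable_comp_of_integrable
      (integrable_normSq_sum_complexGaussian 2 _)
  have eP : ∀ l : Fin L, ∫ p, (phase 0 p.2.1 (finProdFinEquiv (m, l)) - phase 0 p.2.1 r) ^ 2
      ∂(noiseLaw (M * L) s) ≤ 2 * L * s := by
    intro l
    have hmp := measurePreserving_increments (M * L) s
    have := integral_map (μ := noiseLaw (M * L) s) hmp.measurable.aemeasurable
      (f := fun N => (phase 0 N (finProdFinEquiv (m, l)) - phase 0 N r) ^ 2)
      (by rw [hmp.map_eq]; exact (integrable_sq_phase_sub s (hr l)).aestronglyMeasurable)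
    rw [hmp.map_eq, integral_sq_phase_sub s (hr l)] at this
    rw [← this]
    gcongr
    have h := hr' l
    have : ((finProdFinEquiv (m, l) : Fin (M * L)) : ℕ) - (r : ℕ) ≤ 2 * L := by omega
    exact_mod_cast this
  have eW : ∫ p, ‖∑ l : Fin L, p.2.2 (finProdFinEquiv (m, l))‖ ^ 2
      ∂(noiseLaw (M * L) s) = 2 * L := by
    simp_rw [sum_blockSamples]
    have hmp := measurePreserving_additiveNoise (M * L) s
    rw [← integral_map (μ := noiseLaw (M * L) s) hmp.measurable.aemeasurable
      (f := fun w : Fin (M * L) → ℂ => ‖∑ i ∈ blockSamples L m, w i‖ ^ 2)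
      (by rw [hmp.map_eq]; exact (integrable_normSq_sum_complexGaussian 2 _).aestronglyMeasurable)]
    rw [hmp.map_eq, integral_normSq_sum_complexGaussian, card_blockSamples]
    push_cast
    ring
  unfold deviation
  rw [integral_const_mul, integral_add (((integrable_finsetSum _ fun l _ => iP l).const_mul _
    ).const_mul _) (iW.const_mul _), integral_const_mul, integral_const_mul, integral_const_mul,
    integral_finsetSum _ fun l _ => iP l, eW]
  have hsum : (L : ℝ)⁻¹ * ∑ l : Fin L, ∫ p, (phase 0 p.2.1 (finProdFinEquiv (m, l))
      - phase 0 p.2.1 r) ^ 2 ∂(noiseLaw (M * L) s) ≤ 2 * L * s := by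
    rw [inv_mul_le_iff₀ hL']
    simpa using Finset.sum_le_sum fun l (_ : l ∈ Finset.univ) => eP l
  have hW : (L : ℝ)⁻¹ ^ 2 * (2 * L) = 2 / L := by field_simp
  rw [hW]
  gcongr


/-! ### The rate of differential detection -/

/-- The decoding metric: minus `b` times the sum of the squared prediction errors of the symbols
`x₁, …, xₙ` along the chain. -/
noncomputable def metric {n L : ℕ} (A b : ℝ) (x : Fin (n + 1) → ℂ)
    (y : Fin ((n + 1) * L) → ℂ) : ℝ :=
  ∑ i : Fin n, -b * ‖x i.succ - predict (A / 4) (x i.castSucc) (blockMean y i.castSucc)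
    (blockMean y i.succ)‖ ^ 2

theorem measurable_metric {n L : ℕ} (A b : ℝ) :
    Measurable fun p : (Fin (n + 1) → ℂ) × (Fin ((n + 1) * L) → ℂ) => metric A b p.1 p.2 := by
  unfold metric
  refine Finset.measurable_sum _ fun i _ => ?_
  have : Measurable fun p : (Fin (n + 1) → ℂ) × (Fin ((n + 1) * L) → ℂ) =>
      predict (A / 4) (p.1 i.castSucc) (blockMean p.2 i.castSucc) (blockMean p.2 i.succ) :=
    (measurable_predict (A / 4)).comp
      (f := fun p : (Fin (n + 1) → ℂ) × (Fin ((n + 1) * L) → ℂ) =>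
        (p.1 i.castSucc, blockMean p.2 i.castSucc, blockMean p.2 i.succ)) (by fun_prop)
  fun_prop

theorem metric_nonpos {n L : ℕ} (A : ℝ) {b : ℝ} (hb : 0 ≤ b) (x : Fin (n + 1) → ℂ)
    (y : Fin ((n + 1) * L) → ℂ) : metric A b x y ≤ 0 :=
  Finset.sum_nonpos fun i _ => by
    have : 0 ≤ b * ‖x i.succ - predict (A / 4) (x i.castSucc) (blockMean y i.castSucc)
      (blockMean y i.succ)‖ ^ 2 := by positivity
    linarith

/-- The first sample of the block of symbol `m`. -/
def firstSample {M L : ℕ} (hL : 0 < L) (m : Fin M) : Fin (M * L) :=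
  finProdFinEquiv (m, ⟨0, hL⟩)

theorem val_finProdFinEquiv {M L : ℕ} (m : Fin M) (l : Fin L) :
    (finProdFinEquiv (m, l) : ℕ) = l + L * m := rfl

theorem val_firstSample {M L : ℕ} (hL : 0 < L) (m : Fin M) :
    (firstSample hL m : ℕ) = L * m := by
  simp [firstSample]

/-- Both block means entering a prediction are compared with the same reference phase, the one at
the first sample of the earlier block. -/
noncomputable def pairDeviation {n L : ℕ} (hL : 0 < L) (A : ℝ) (i : Fin n)
    (p : ℝ × (Fin ((n + 1) * L) → ℝ) × (Fin ((n + 1) * L) → ℂ)) : ℝ :=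
  deviation A (firstSample hL i.castSucc) i.castSucc p.2.1 p.2.2 +
    deviation A (firstSample hL i.castSucc) i.succ p.2.1 p.2.2

theorem firstSample_le_castSucc {n L : ℕ} (hL : 0 < L) (i : Fin n) (l : Fin L) :
    firstSample hL i.castSucc ≤ finProdFinEquiv (i.castSucc, l) := by
  rw [Fin.le_def, val_firstSample, val_finProdFinEquiv]
  omega

theorem firstSample_le_succ {n L : ℕ} (hL : 0 < L) (i : Fin n) (l : Fin L) :
    firstSample hL i.castSucc ≤ finProdFinEquiv (i.succ, l) := by
  rw [Fin.le_def, val_firstSample, val_finProdFinEquiv, Fin.val_castSucc, Fin.val_succ, mul_add]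
  omega

theorem integrable_pairDeviation {n L : ℕ} (hL : 0 < L) (s : ℝ≥0) (A : ℝ) (i : Fin n) :
    Integrable (pairDeviation hL A i) (noiseLaw ((n + 1) * L) s) :=
  (integrable_deviation s A _ _ (firstSample_le_castSucc hL i)).add
    (integrable_deviation s A _ _ (firstSample_le_succ hL i))

theorem integral_pairDeviation_le {n L : ℕ} (hL : 0 < L) (s : ℝ≥0) (A : ℝ) (i : Fin n) :
    ∫ p, pairDeviation hL A i p ∂(noiseLaw ((n + 1) * L) s)
      ≤ 4 * (A ^ 2 * (2 * L * s) + 2 / L) := by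
  unfold pairDeviation
  rw [integral_add (integrable_deviation s A _ _ (firstSample_le_castSucc hL i))
    (integrable_deviation s A _ _ (firstSample_le_succ hL i))]
  have h1 := integral_deviation_le hL s A _ _ (firstSample_le_castSucc hL i) fun l => by
    rw [val_firstSample, val_finProdFinEquiv]
    omega
  have h2 := integral_deviation_le hL s A _ _ (firstSample_le_succ hL i) fun l => by
    rw [val_firstSample, val_finProdFinEquiv, Fin.val_castSucc, Fin.val_succ, mul_add]
    omega
  linarith

theorem neg_sum_pairDeviation_le_metric {n L : ℕ} (hL : 0 < L) {A b : ℝ} (hA : 0 < A)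
    (hb : 0 ≤ b) {x : Fin (n + 1) → ℂ} (hx : ∀ m, A / 2 ≤ ‖x m‖ ∧ ‖x m‖ ≤ A)
    (p : ℝ × (Fin ((n + 1) * L) → ℝ) × (Fin ((n + 1) * L) → ℂ)) :
    -(32 * b * ∑ i : Fin n, pairDeviation hL A i p)
      ≤ metric A b x (output x p.1 p.2.1 p.2.2) := by
  rw [Finset.mul_sum, ← Finset.sum_neg_distrib, metric]
  refine Finset.sum_le_sum fun i _ => ?_
  have h := norm_sub_predict_sq_le (z := blockMean (output x p.1 p.2.1 p.2.2) i.castSucc)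
    (z' := blockMean (output x p.1 p.2.1 p.2.2) i.succ) hA (hx i.castSucc).1 (hx i.castSucc).2
    (hx i.succ).2
    (Complex.norm_exp_I_mul_ofReal (phase p.1 p.2.1 (firstSample hL i.castSucc)))
  have h1 := norm_blockMean_output_sub_sq_le hL (firstSample hL i.castSucc) i.castSucc
    (hx i.castSucc).2 p.1 p.2.1 p.2.2
  have h2 := norm_blockMean_output_sub_sq_le hL (firstSample hL i.castSucc) i.succ
    (hx i.succ).2 p.1 p.2.1 p.2.2
  have h3 := mul_le_mul_of_nonneg_left (h.trans (mul_le_mul_of_nonneg_left (add_le_add h1 h2)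
    (by norm_num))) hb
  rw [pairDeviation]
  linarith

theorem ae_pi_symbolLaw {A : ℝ} (hA : 0 < A) (M : ℕ) :
    ∀ᵐ x ∂(Measure.pi fun _ : Fin M => symbolLaw A), ∀ m, A / 2 ≤ ‖x m‖ ∧ ‖x m‖ ≤ A := by
  have := isProbabilityMeasure_symbolLaw hA
  rw [ae_all_iff]
  exact fun m => (measurePreserving_eval (fun _ : Fin M => symbolLaw A) m).quasiMeasurePreserving.ae
    (ae_symbolLaw hA)

theorem fst_jointLaw {M : ℕ} (L : ℕ) (σsq : ℝ) (μ : Measure (Fin M → ℂ))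
    [IsProbabilityMeasure μ] : (jointLaw L σsq μ).fst = μ := by
  rw [jointLaw, Measure.fst, Measure.map_map measurable_fst (measurable_output M L)]
  exact measurePreserving_fst.map_eq

theorem le_integral_metric {n L : ℕ} (hL : 0 < L) {A b σsq : ℝ} (hA : 0 < A) (hb : 0 ≤ b)
    (hσ : 0 ≤ σsq) :
    Integrable (fun p => metric A b p.1 p.2)
      (jointLaw L σsq (Measure.pi fun _ : Fin (n + 1) => symbolLaw A)) ∧
    -(n * (256 * b * (A ^ 2 * σsq + 1 / L)))
      ≤ ∫ p, metric A b p.1 p.2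
        ∂(jointLaw L σsq (Measure.pi fun _ : Fin (n + 1) => symbolLaw A)) := by
  have := isProbabilityMeasure_symbolLaw hA
  have hL' : (0 : ℝ) < L := by exact_mod_cast hL
  set s := Real.toNNReal (σsq / L) with hs
  set μ := Measure.pi fun _ : Fin (n + 1) => symbolLaw A with hμ
  have hmO := measurable_output (n + 1) L
  have hmet := measurable_metric (n := n) (L := L) A b
  have hD : Integrable (fun p => -(32 * b * ∑ i : Fin n, pairDeviation hL A i p))
      (noiseLaw ((n + 1) * L) s) :=
    ((integrable_finsetSum _ fun i _ => integrable_pairDeviation hL s A i).const_mul _).neg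
  have hD' : Integrable (fun q : (Fin (n + 1) → ℂ) × ℝ × (Fin ((n + 1) * L) → ℝ) ×
      (Fin ((n + 1) * L) → ℂ) => -(32 * b * ∑ i : Fin n, pairDeviation hL A i q.2))
      (μ.prod (noiseLaw ((n + 1) * L) s)) :=
    measurePreserving_snd.integrable_comp_of_integrable hD
  have hae : ∀ᵐ q ∂(μ.prod (noiseLaw ((n + 1) * L) s)),
      -(32 * b * ∑ i : Fin n, pairDeviation hL A i q.2)
        ≤ metric A b q.1 (output q.1 q.2.1 q.2.2.1 q.2.2.2) := by
    filter_upwards [measurePreserving_fst.quasiMeasurePreserving.ae (ae_pi_symbolLaw hA (n + 1))]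
      with q hq using neg_sum_pairDeviation_le_metric hL hA hb hq q.2
  have hint : Integrable (fun q : (Fin (n + 1) → ℂ) × ℝ × (Fin ((n + 1) * L) → ℝ) ×
      (Fin ((n + 1) * L) → ℂ) => metric A b q.1 (output q.1 q.2.1 q.2.2.1 q.2.2.2))
      (μ.prod (noiseLaw ((n + 1) * L) s)) := by
    refine Integrable.mono hD' (hmet.comp hmO).aestronglyMeasurable ?_
    filter_upwards [hae] with q hq
    have hle := metric_nonpos (L := L) A hb q.1 (output q.1 q.2.1 q.2.2.1 q.2.2.2)
    rw [Real.norm_of_nonpos hle, Real.norm_of_nonpos (hq.trans hle)]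
    linarith
  refine ⟨(integrable_map_measure hmet.aestronglyMeasurable hmO.aemeasurable).mpr hint, ?_⟩
  rw [jointLaw, integral_map hmO.aemeasurable hmet.aestronglyMeasurable]
  refine le_trans ?_ (integral_mono_ae hD' hint hae)
  have hsnd : ∫ q, -(32 * b * ∑ i : Fin n, pairDeviation hL A i q.2)
      ∂(μ.prod (noiseLaw ((n + 1) * L) s))
      = ∫ p, -(32 * b * ∑ i : Fin n, pairDeviation hL A i p) ∂(noiseLaw ((n + 1) * L) s) := by
    have := integral_map (μ := μ.prod (noiseLaw ((n + 1) * L) s)) measurable_snd.aemeasurable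
      (f := fun p => -(32 * b * ∑ i : Fin n, pairDeviation hL A i p))
      (by rw [measurePreserving_snd.map_eq]; exact hD.aestronglyMeasurable)
    rw [measurePreserving_snd.map_eq] at this
    exact this.symm
  rw [hsnd, integral_neg, integral_const_mul,
    integral_finsetSum _ fun i _ => integrable_pairDeviation hL s A i, neg_le_neg_iff]
  have hs' : (s : ℝ) = σsq / L := Real.coe_toNNReal _ (by positivity)
  calc _ ≤ 32 * b * ∑ i : Fin n, 4 * (A ^ 2 * (2 * L * s) + 2 / L) := by
        gcongr with i
        exact integral_pairDeviation_le hL s A i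
    _ = n * (256 * b * (A ^ 2 * σsq + 1 / L)) := by
        rw [hs']
        simp only [Finset.sum_const, Finset.card_univ, Fintype.card_fin, nsmul_eq_mul]
        field_simp
        ring

/-- For every output sequence the exponential of the metric has a small mean over the inputs, hence
also over independent input and output. -/
theorem integral_exp_metric_le {n L : ℕ} {A b : ℝ} (hA : 0 < A) (hb : 0 < b)
    (η : Measure (Fin ((n + 1) * L) → ℂ)) [IsProbabilityMeasure η] :
    Integrable (fun p => Real.exp (metric A b p.1 p.2))
      ((Measure.pi fun _ : Fin (n + 1) => symbolLaw A).prod η) ∧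
    ∫ p, Real.exp (metric A b p.1 p.2)
      ∂((Measure.pi fun _ : Fin (n + 1) => symbolLaw A).prod η) ≤ (16 / (A ^ 2 * b)) ^ n := by
  have := isProbabilityMeasure_symbolLaw hA
  have hm := (measurable_metric (n := n) (L := L) A b).exp
  have hint : Integrable (fun p => Real.exp (metric A b p.1 p.2))
      ((Measure.pi fun _ : Fin (n + 1) => symbolLaw A).prod η) := by
    refine Integrable.of_bound hm.aestronglyMeasurable 1 (ae_of_all _ fun p => ?_)
    rw [Real.norm_of_nonneg (Real.exp_pos _).le, Real.exp_le_one_iff]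
    exact metric_nonpos A hb.le _ _
  refine ⟨hint, ?_⟩
  rw [integral_eq_lintegral_of_nonneg_ae (ae_of_all _ fun p => (Real.exp_pos _).le)
    hm.aestronglyMeasurable]
  refine ENNReal.toReal_le_of_le_ofReal (by positivity) ?_
  rw [lintegral_prod_symm' _ hm.ennreal_ofReal]
  calc _ ≤ ∫⁻ y, ENNReal.ofReal (16 / (A ^ 2 * b)) ^ n ∂η := by
        refine lintegral_mono fun y => ?_
        refine le_trans (le_of_eq ?_) (lintegral_prod_chain_le (ν := symbolLaw A) n
          (fun i a x => ENNReal.ofReal (Real.exp (-b * ‖x - predict (A / 4) a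
            (blockMean y i.castSucc) (blockMean y i.succ)‖ ^ 2))) (fun i => ?_)
          fun i a => lintegral_gaussianKernel_symbolLaw_le hA hb _)
        · refine lintegral_congr fun x => ?_
          simp only [metric, Real.exp_sum]
          exact ENNReal.ofReal_prod_of_nonneg fun i _ => (Real.exp_pos _).le
        · have hp : Measurable fun q : ℂ × ℂ => predict (A / 4) q.1 (blockMean y i.castSucc)
              (blockMean y i.succ) :=
            (measurable_predict (A / 4)).comp (f := fun q : ℂ × ℂ =>
              (q.1, blockMean y i.castSucc, blockMean y i.succ)) (by fun_prop)
          simp only [Function.uncurry_def]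
          fun_prop
    _ = ENNReal.ofReal ((16 / (A ^ 2 * b)) ^ n) := by
        rw [lintegral_const, measure_univ, mul_one, ENNReal.ofReal_pow (by positivity)]

theorem le_mutualInfo {n L : ℕ} (hL : 0 < L) {P σsq : ℝ} (hP : 0 < P) (hσ : 0 ≤ σsq) :
    ENNReal.ofReal (n * (-Real.log (σsq + 1 / P) - (Real.log 16 + 256))) ≤
      mutualInfo (jointLaw L σsq
        (Measure.pi fun _ : Fin (n + 1) => symbolLaw (Real.sqrt (P / L)))) := by
  have hL' : (0 : ℝ) < L := by exact_mod_cast hL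
  set A := Real.sqrt (P / L) with hAdef
  have hA : 0 < A := Real.sqrt_pos.mpr (by positivity)
  have hA2 : A ^ 2 = P / L := Real.sq_sqrt (by positivity)
  have hε : 0 < σsq + 1 / P := by positivity
  -- The width of the kernel matches the mean squared deviation, `A ^ 2 * (σsq + 1 / P)`.
  set b := 1 / (A ^ 2 * (σsq + 1 / P)) with hbdef
  have hb : 0 < b := by positivity
  have := isProbabilityMeasure_symbolLaw hA
  have := isProbabilityMeasure_jointLaw L σsq (Measure.pi fun _ : Fin (n + 1) => symbolLaw A)
  obtain ⟨hint, hle⟩ := le_integral_metric (n := n) hL hA hb.le hσ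
  obtain ⟨hexp, hexple⟩ := integral_exp_metric_le (n := n) (L := L) hA hb
    (jointLaw L σsq (Measure.pi fun _ : Fin (n + 1) => symbolLaw A)).snd
  rw [mutualInfo, fst_jointLaw]
  refine le_trans (ENNReal.ofReal_le_ofReal ?_)
    (ofReal_integral_sub_log_integral_exp_le_klDiv hint hexp)
  have hlog := Real.log_le_log (integral_exp_pos hexp) hexple
  have h16 : 16 / (A ^ 2 * b) = 16 * (σsq + 1 / P) := by
    rw [hbdef]
    field_simp
  have h256 : 256 * b * (A ^ 2 * σsq + 1 / L) = 256 := by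
    rw [hbdef, hA2]
    field_simp
  rw [h16, Real.log_pow, Real.log_mul (by norm_num) hε.ne'] at hlog
  rw [h256] at hle
  linarith

theorem pi_symbolLaw_mem_inputLaws {M L : ℕ} (hM : 0 < M) (hL : 0 < L) {P : ℝ} (hP : 0 < P) :
    (Measure.pi fun _ : Fin M => symbolLaw (Real.sqrt (P / L))) ∈ inputLaws M L P := by
  have hL' : (0 : ℝ) < L := by exact_mod_cast hL
  have hA : 0 < Real.sqrt (P / L) := Real.sqrt_pos.mpr (by positivity)
  have := isProbabilityMeasure_symbolLaw hA
  refine ⟨inferInstance, ?_⟩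
  have hle : ∀ m : Fin M, ∫⁻ x, ‖x m‖ₑ ^ 2
      ∂(Measure.pi fun _ : Fin M => symbolLaw (Real.sqrt (P / L))) ≤ ENNReal.ofReal (P / L) := by
    intro m
    calc _ ≤ ∫⁻ x, ENNReal.ofReal (P / L)
          ∂(Measure.pi fun _ : Fin M => symbolLaw (Real.sqrt (P / L))) := by
          refine lintegral_mono_ae ?_
          filter_upwards [ae_pi_symbolLaw hA M] with x hx
          rw [← ofReal_norm, ← ENNReal.ofReal_pow (norm_nonneg _)]
          refine ENNReal.ofReal_le_ofReal ?_
          calc ‖x m‖ ^ 2 ≤ Real.sqrt (P / L) ^ 2 := by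
                gcongr
                exact (hx m).2
            _ = P / L := Real.sq_sqrt (by positivity)
      _ = _ := by rw [lintegral_const, measure_univ, mul_one]
  calc _ ≤ (M : ℝ≥0∞)⁻¹ * ∑ m : Fin M, ENNReal.ofReal (P / L) := by
        gcongr with m
        exact hle m
    _ = ENNReal.ofReal (P / L) := by
        rw [Finset.sum_const, Finset.card_univ, Fintype.card_fin, nsmul_eq_mul, ← mul_assoc,
          ENNReal.inv_mul_cancel (by simpa using hM.ne') (ENNReal.natCast_ne_top M), one_mul]

/-- The capacity is at least the logarithm of the inverse effective noise-to-signal ratio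
`σ² + 1 / P`, up to an absolute constant. -/
theorem le_capacity {L : ℕ} (hL : 0 < L) {P σsq : ℝ} (hP : 0 < P) (hσ : 0 ≤ σsq) :
    ENNReal.ofReal (-Real.log (σsq + 1 / P) - (Real.log 16 + 256)) ≤ capacity P L σsq := by
  set R := -Real.log (σsq + 1 / P) - (Real.log 16 + 256)
  -- The first symbol only serves as a phase reference, hence the factor `(M - 1) / M`.
  have hlim : Tendsto (fun M : ℕ => ENNReal.ofReal ((1 - (M : ℝ)⁻¹) * R)) atTop
      (𝓝 (ENNReal.ofReal R)) := by
    refine (ENNReal.continuous_ofReal.tendsto _).comp ?_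
    simpa using (tendsto_const_nhds (x := (1 : ℝ)).sub
      (tendsto_inv_atTop_nhds_zero_nat (𝕜 := ℝ))).mul_const R
  rw [← hlim.liminf_eq]
  refine liminf_le_liminf ?_
  filter_upwards [eventually_gt_atTop 0] with M hM
  obtain ⟨n, rfl⟩ := Nat.exists_eq_add_one_of_ne_zero hM.ne'
  refine le_trans ?_ (le_iSup₂_of_le _ (pi_symbolLaw_mem_inputLaws hM hL hP) le_rfl)
  refine le_trans ?_ (ENNReal.div_le_div_right (le_mutualInfo hL hP hσ) _)
  rw [← ENNReal.ofReal_natCast (n + 1), ← ENNReal.ofReal_div_of_pos (by positivity)]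
  refine ENNReal.ofReal_le_ofReal (le_of_eq ?_)
  change (1 - ((n + 1 : ℕ) : ℝ)⁻¹) * R = n * R / ((n + 1 : ℕ) : ℝ)
  clear_value R
  push_cast
  field_simp
  ring

/-! ### Asymptotics in the power -/

theorem log_rpow_add_inv_le {β P : ℝ} (hβ : β ≤ 0) (hP : 1 < P) :
    Real.log (P ^ β + 1 / P) ≤ Real.log 2 - gdofInCC β * Real.log P := by
  have hP0 : 0 < P := by linarith
  have hd : β ≤ -gdofInCC β ∧ -1 ≤ -gdofInCC β := by
    unfold gdofInCC
    split_ifs <;> constructor <;> linarith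
  have h1 : P ^ β ≤ P ^ (-gdofInCC β) := Real.rpow_le_rpow_of_exponent_le hP.le hd.1
  have h2 : 1 / P ≤ P ^ (-gdofInCC β) := by
    rw [one_div, ← Real.rpow_neg_one]
    exact Real.rpow_le_rpow_of_exponent_le hP.le hd.2
  have hpos : 0 < P ^ (-gdofInCC β) := Real.rpow_pos_of_pos hP0 _
  calc _ ≤ Real.log (2 * P ^ (-gdofInCC β)) := by
        refine Real.log_le_log (by positivity) ?_
        linarith
    _ = _ := by
        rw [Real.log_mul (by norm_num) hpos.ne', Real.log_rpow hP0]
        ring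

theorem gdofInCC_le_liminf_capacityRatio {α β : ℝ} (hα : 0 ≤ α) :
    ENNReal.ofReal (gdofInCC β) ≤ liminf (capacityRatio α β) atTop := by
  rcases lt_or_ge 0 β with hβ | hβ
  · simp [gdofInCC, hβ]
  set C : ℝ := Real.log 2 + (Real.log 16 + 256)
  have hlim : Tendsto (fun P : ℝ => ENNReal.ofReal (gdofInCC β - C / Real.log P)) atTop
      (𝓝 (ENNReal.ofReal (gdofInCC β))) := by
    refine (ENNReal.continuous_ofReal.tendsto _).comp ?_
    simpa using tendsto_const_nhds.sub (Real.tendsto_log_atTop.const_div_atTop C)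
  rw [← hlim.liminf_eq]
  refine liminf_le_liminf ?_
  filter_upwards [eventually_gt_atTop 1] with P hP
  have hP0 : 0 < P := by linarith
  have hlogP : 0 < Real.log P := Real.log_pos hP
  have hL : 0 < ⌊P ^ α⌋₊ := Nat.floor_pos.mpr (Real.one_le_rpow hP.le hα)
  refine le_trans ?_ (ENNReal.div_le_div_right
    (le_capacity hL hP0 (Real.rpow_nonneg hP0.le β)) _)
  rw [← ENNReal.ofReal_div_of_pos hlogP]
  refine ENNReal.ofReal_le_ofReal ?_
  rw [le_div_iff₀ hlogP, sub_mul, div_mul_cancel₀ _ hlogP.ne']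
  have := log_rpow_add_inv_le hβ hP
  simp only [C]
  linarith

end OWPN

theorem mainTheorem7 (α β : ℝ) (hα : 0 ≤ α) :
    ENNReal.ofReal (OWPN.gdofInCC β) ≤ liminf (OWPN.capacityRatio α β) atTop ∧
    ∀ D : ℝ≥0∞, OWPN.IsGDoF α β D → ENNReal.ofReal (OWPN.gdofInCC β) ≤ D := by
  have h := OWPN.gdofInCC_le_liminf_capacityRatio (β := β) hα
  exact ⟨h, fun D hD => hD.liminf_eq ▸ h⟩
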